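/- Let $0<\alpha<n$ and let $A,b>0$. There is a constant $c>0$, depending only on $n,\alpha,A,b$, with the following property. Let $L$ be a linear operator on $L^2(\mathbb R^n)$ such that $-L$ generates an analytic semigroup $(e^{-tL})_{t\ge 0}$, and suppose that $e^{-tL}$ is given for $t>0$ by a kernel $p_t(x,y)$, measurable in $(t,x,y)$, with $$|p_t(x,y)|\le \frac{A}{t^{n/2}}\,e^{-b|x-y|^2/t}\qquad (t>0,\ x,y\in\mathbb R^n).$$ Put $e^{-tL}g(x)=\int_{\mathbb R^n} p_t(x,y)g(y)\,dy$ and $$L^{-\alpha/2}f(x)=\frac1{\Gamma(\alpha/2)}\int_0^\infty t^{\alpha/2-1}e^{-tL}f(x)\,dt,\qquad F(x)=\frac1{\Gamma(\alpha/2)}\int_0^\infty t^{\alpha/2-1}|e^{-tL}f(x)|\,dt .$$ Let $\mathcal M$ be the set of locally integrable functions $g$ on $\mathbb R^n$ with $\int |g(x)|^2(1+|x|^{n+d})^{-1}dx<\infty$ for some $d>0$, and let $\mathrm{BMO}_L(\mathbb R^n)$ be the set of $g\in\mathcal M$ with $$\|g\|_{\mathrm{BMO}_L}=\sup_{y\in\mathbb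 R^n,\ r>0}\frac1{|B(y,r)|}\int_{B(y,r)}|g(x)-e^{-r^2L}g(x)|\,dx<\infty .$$ Let $f\in L^{n/\alpha}(\mathbb R^n)$ be such that $L^{-\alpha/2}f$ is finite almost everywhere, in the sense that $F<\infty$ almost everywhere. Then: (1) for every $r>0$ the integral $$e^{-r^2L}L^{-\alpha/2}f(x):=\frac1{\Gamma(\alpha/2)}\int_0^\infty t^{\alpha/2-1}e^{-(t+r^2)L}f(x)\,dt$$ converges absolutely for almost every $x$, and for every ball $B(y,r)$ $$\frac1{|B(y,r)|}\int_{B(y,r)}\big|L^{-\alpha/2}f(x)-e^{-r^2L}L^{-\alpha/2}f(x)\big|\,dx\le c\,\|f\|_{L^{n/\alpha}} ;$$ (2) if moreover the integral defining $L^{-\alpha/2}f$ converges absolutely in the class $\mathcal M$, that is, $F\in\mathcal M$ (for nonnegative $f$ and $p_t$ this says just that $L^{-\alpha/2}f\in\mathcal M$, the class of functions for which the norm of $\mathrm{BMO}_L$ is defined), then $L^{-\alpha/2}f\in\mathrm{BMO}_L(\mathbb R^n)$, the function $e^{-r^2L}L^{-\alpha/2}f$ of (1) equals $e^{-r^2L}$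 applied to $L^{-\alpha/2}f$ almost everywhere for every $r>0$, and $$\|L^{-\alpha/2}f\|_{\mathrm{BMO}_L(\mathbb R^n)}\le c\,\|f\|_{L^{n/\alpha}} .$$ -/

import Mathlib

open MeasureTheory Set Filter Topology
open scoped ENNReal

noncomputable section

/-- Euclidean space of dimension `n`. -/
abbrev Eucl (n : ℕ) : Type := EuclideanSpace ℝ (Fin n)

/-- The Hilbert space of square integrable complex functions for Lebesgue measure. -/
abbrev L2Space (n : ℕ) : Type := Lp ℂ 2 (volume : Measure (Eucl n))

/-- The open sector of half-angle `θ` around the positive real axis. -/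
def openSector (θ : ℝ) : Set ℂ := {z | z ≠ 0 ∧ |z.arg| < θ}

/-- `T` is an analytic semigroup of bounded operators: it extends to a holomorphic family on some
sector, obeying the semigroup law there and tending strongly to the identity at `0`
inside the sector. Only the values `T t` with `0 ≤ t` matter. -/
def IsAnalyticSemigroup {H : Type*} [NormedAddCommGroup H] [NormedSpace ℂ H]
    (T : ℝ → H →L[ℂ] H) : Prop :=
  ∃ θ : ℝ, 0 < θ ∧ θ ≤ Real.pi / 2 ∧ ∃ S : ℂ → H →L[ℂ] H,
    S 0 = ContinuousLinearMap.id ℂ H ∧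
    DifferentiableOn ℂ S (openSector θ) ∧
    (∀ z ∈ openSector θ, ∀ w ∈ openSector θ, S (z + w) = (S z).comp (S w)) ∧
    (∀ u : H, Tendsto (fun z => S z u) (𝓝[openSector θ] 0) (𝓝 u)) ∧
    ∀ t : ℝ, 0 ≤ t → T t = S (t : ℂ)

/-- `T t = e^{-tL}`: the operator `-L`, with its domain, is the infinitesimal generator of `T`. -/
def IsSemigroupOf {H : Type*} [NormedAddCommGroup H] [NormedSpace ℂ H]
    (L : H →ₗ.[ℂ] H) (T : ℝ → H →L[ℂ] H) : Prop :=
  ∀ u v : H, (u, v) ∈ L.graph ↔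
    Tendsto (fun t : ℝ => ((t⁻¹ : ℝ) : ℂ) • (u - T t u)) (𝓝[>] 0) (𝓝 v)

/-- `p` is the family of integral kernels of the operators `T t`, `t > 0`, on `L²`. -/
structure IsSemigroupKernel {n : ℕ} (T : ℝ → L2Space n →L[ℂ] L2Space n)
    (p : ℝ → Eucl n → Eucl n → ℂ) : Prop where
  measurable : Measurable fun q : ℝ × Eucl n × Eucl n => p q.1 q.2.1 q.2.2
  represents : ∀ t : ℝ, 0 < t → ∀ u : L2Space n,
    (T t u : Eucl n → ℂ) =ᵐ[volume] fun x => ∫ y, p t x y * u y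

/-- The Gaussian upper bound with constants `A` and `b`. -/
def GaussianBound {n : ℕ} (A b : ℝ) (p : ℝ → Eucl n → Eucl n → ℂ) : Prop :=
  ∀ t : ℝ, 0 < t → ∀ x y : Eucl n,
    ‖p t x y‖ ≤ A / t ^ ((n : ℝ) / 2) * Real.exp (-b * ‖x - y‖ ^ 2 / t)

/-- The action `e^{-tL} g (x) = ∫ p_t(x,y) g(y) dy` of the semigroup on functions. -/
def heatApply {n : ℕ} (p : ℝ → Eucl n → Eucl n → ℂ) (t : ℝ) (g : Eucl n → ℂ) (x : Eucl n) : ℂ :=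
  ∫ y, p t x y * g y

/-- The class `𝓜`: locally integrable functions with
`∫ |g(x)|² / (1 + |x|^{n+d}) dx < ∞` for some `d > 0`. -/
def MemM {n : ℕ} {F : Type*} [NormedAddCommGroup F] (g : Eucl n → F) : Prop :=
  LocallyIntegrable g (volume : Measure (Eucl n)) ∧
    ∃ d : ℝ, 0 < d ∧
      Integrable (fun x : Eucl n => ‖g x‖ ^ 2 / (1 + ‖x‖ ^ ((n : ℝ) + d))) volume

/-- The mean of `|h|` over the open ball `B(y,r)`. -/
def ballMean {n : ℕ} (y : Eucl n) (r : ℝ) (h : Eucl n → ℂ) : ℝ≥0∞ :=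
  (volume (Metric.ball y r))⁻¹ * ∫⁻ x in Metric.ball y r, ‖h x‖ₑ

/-- The seminorm `sup_{B(y,r)} |B|⁻¹ ∫_B |g - e^{-r²L} g|`. -/
def bmoNorm {n : ℕ} (p : ℝ → Eucl n → Eucl n → ℂ) (g : Eucl n → ℂ) : ℝ≥0∞ :=
  ⨆ (y : Eucl n) (r : ℝ) (_ : 0 < r), ballMean y r (fun x => g x - heatApply p (r ^ 2) g x)

/-- Membership in `BMO_L(ℝⁿ)`. -/
def MemBMO {n : ℕ} (p : ℝ → Eucl n → Eucl n → ℂ) (g : Eucl n → ℂ) : Prop :=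
  MemM g ∧ bmoNorm p g < ⊤

/-- `L^{-α/2} f (x) = Γ(α/2)⁻¹ ∫₀^∞ t^{α/2-1} e^{-tL} f(x) dt`. -/
def fracPow {n : ℕ} (p : ℝ → Eucl n → Eucl n → ℂ) (α : ℝ) (f : Eucl n → ℂ) (x : Eucl n) : ℂ :=
  ((Real.Gamma (α / 2))⁻¹ : ℝ) • ∫ t in Ioi (0 : ℝ), (t ^ (α / 2 - 1) : ℝ) • heatApply p t f x

/-- `Γ(α/2)⁻¹ ∫₀^∞ t^{α/2-1} |e^{-tL} f(x)| dt`; it is finite exactly where the integral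
that defines `L^{-α/2} f (x)` converges absolutely. -/
def fracPowAbs {n : ℕ} (p : ℝ → Eucl n → Eucl n → ℂ) (α : ℝ) (f : Eucl n → ℂ) (x : Eucl n) :
    ℝ≥0∞ :=
  ENNReal.ofReal (Real.Gamma (α / 2))⁻¹ *
    ∫⁻ t in Ioi (0 : ℝ), ENNReal.ofReal (t ^ (α / 2 - 1)) * ‖heatApply p t f x‖ₑ

/-- The composite `e^{-sL} L^{-α/2} f`, with `e^{-sL}` taken under the integral:
`Γ(α/2)⁻¹ ∫₀^∞ t^{α/2-1} e^{-(t+s)L} f(x) dt`. -/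
def heatFracPow {n : ℕ} (p : ℝ → Eucl n → Eucl n → ℂ) (α s : ℝ) (f : Eucl n → ℂ)
    (x : Eucl n) : ℂ :=
  ((Real.Gamma (α / 2))⁻¹ : ℝ) •
    ∫ t in Ioi (0 : ℝ), (t ^ (α / 2 - 1) : ℝ) • heatApply p (t + s) f x

end

/-! Put `h = r²` and `a = α/2 - 1`, and let `t₊^a` be `t^a` for `t > 0` and `0` otherwise. A
translation in time turns the oscillation into one integral, `L^{-α/2}f - e^{-hL}L^{-α/2}f =
Γ(α/2)⁻¹ ∫ (t₊^a - (t-h)₊^a) e^{-tL}f dt`, so the cancellation sits entirely in the scalar weight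
and no time derivative of the semigroup has to be estimated.

Hölder against the Gaussian gives `|e^{-tL}f| ≤ C t^{-α/2} ‖f‖` pointwise. Alone this leaves `dt/t`
near `0`, which diverges. Averaging over a ball of radius `r` supplies the missing bound `C h^{-α/2}
‖f‖` (`ballMean_heatApply_le`). Against the minimum of the two bounds the weight has a mass that
does not depend on `h` (`lintegral_weight_scaled`) and is finite (`weightMass_lt_top`): `a > -1`
handles the singularities, and the difference of the powers gains a factor `1/t` at infinity. This
gives the estimate in `ballMean_fracPow_sub_le`.

For the second part, `e^{-sL}` is moved under the time integral by Fubini (`heatApply_fracPow`).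
Absolute convergence holds because a function of the class `𝓜` is integrable against Gaussians, and
the semigroup law passes from `L²` to `L^{n/α}` by truncation (`heatApply_heatApply`). -/

/-- The Gaussian `A t^{-n/2} e^{-b|v|²/t}`. -/
noncomputable def gaussKernel {n : ℕ} (A b t : ℝ) (v : Eucl n) : ℝ :=
  A / t ^ ((n : ℝ) / 2) * Real.exp (-b * ‖v‖ ^ 2 / t)

/-! ### Gaussian integrals and Hölder estimates -/

section Gaussian

variable {n : ℕ} {A b t : ℝ}

lemma gaussKernel_nonneg (hA : 0 < A) (ht : 0 < t) (v : Eucl n) : 0 ≤ gaussKernel A b t v := by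
  unfold gaussKernel; positivity

lemma continuous_gaussKernel : Continuous (gaussKernel A b t : Eucl n → ℝ) := by
  unfold gaussKernel; fun_prop

lemma measurable_gaussKernel : Measurable (gaussKernel A b t : Eucl n → ℝ) :=
  continuous_gaussKernel.measurable

lemma integrable_exp_neg_mul_norm_sq {c : ℝ} (hc : 0 < c) :
    Integrable (fun v : Eucl n => Real.exp (-c * ‖v‖ ^ 2)) := by
  have h := (GaussianFourier.integrable_cexp_neg_mul_sq_norm_add (V := Eucl n) (b := (c : ℂ))
    (by simpa using hc) 0 0).norm
  refine h.congr (ae_of_all _ fun v => ?_)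
  simp only [Complex.norm_exp]
  congr 1
  norm_cast
  simp

lemma lintegral_exp_neg_mul_norm_sq {c : ℝ} (hc : 0 < c) :
    ∫⁻ v : Eucl n, ENNReal.ofReal (Real.exp (-c * ‖v‖ ^ 2)) =
      ENNReal.ofReal ((Real.pi / c) ^ ((n : ℝ) / 2)) := by
  rw [← ofReal_integral_eq_lintegral_ofReal (integrable_exp_neg_mul_norm_sq hc)
    (ae_of_all _ fun v => (Real.exp_pos _).le), GaussianFourier.integral_rexp_neg_mul_sq_norm hc]
  simp

lemma lintegral_gaussKernel_rpow (hA : 0 < A) (hb : 0 < b) (ht : 0 < t) {q : ℝ} (hq : 0 < q) :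
    (∫⁻ v : Eucl n, ENNReal.ofReal (gaussKernel A b t v) ^ q) ^ (1 / q) =
      ENNReal.ofReal (A * (Real.pi / (b * q)) ^ ((n : ℝ) / (2 * q)) *
        t ^ (-(n : ℝ) / 2 + n / (2 * q))) := by
  have h1 : ∀ v : Eucl n, ENNReal.ofReal (gaussKernel A b t v) ^ q =
      ENNReal.ofReal ((A / t ^ ((n : ℝ) / 2)) ^ q) *
        ENNReal.ofReal (Real.exp (-(b * q / t) * ‖v‖ ^ 2)) := by
    intro v
    rw [ENNReal.ofReal_rpow_of_nonneg (gaussKernel_nonneg hA ht v) hq.le, gaussKernel,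
      Real.mul_rpow (by positivity) (by positivity), ENNReal.ofReal_mul (by positivity),
      ← Real.exp_mul]
    congr 3
    ring
  simp_rw [h1]
  rw [lintegral_const_mul' _ _ ENNReal.ofReal_ne_top, lintegral_exp_neg_mul_norm_sq (by positivity),
    ← ENNReal.ofReal_mul (by positivity), ENNReal.ofReal_rpow_of_nonneg (by positivity)
    (by positivity)]
  congr 1
  rw [Real.mul_rpow (by positivity) (by positivity), ← Real.rpow_mul (by positivity),
    ← Real.rpow_mul (by positivity), mul_one_div_cancel hq.ne', Real.rpow_one]
  have e1 : Real.pi / (b * q / t) = Real.pi / (b * q) * t := by field_simp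
  have e2 : (n : ℝ) / 2 * (1 / q) = n / (2 * q) := by field_simp
  rw [e1, e2, Real.mul_rpow (by positivity) ht.le, Real.rpow_add ht, neg_div, Real.rpow_neg ht.le]
  field_simp

lemma lintegral_gaussKernel (hA : 0 < A) (hb : 0 < b) (ht : 0 < t) :
    ∫⁻ v : Eucl n, ENNReal.ofReal (gaussKernel A b t v) =
      ENNReal.ofReal (A * (Real.pi / b) ^ ((n : ℝ) / 2)) := by
  have h := lintegral_gaussKernel_rpow (n := n) hA hb ht one_pos
  simpa [neg_div] using h

lemma lintegral_gaussKernel_sub_left (x : Eucl n) (hA : 0 < A) (hb : 0 < b) (ht : 0 < t) :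
    ∫⁻ y : Eucl n, ENNReal.ofReal (gaussKernel A b t (x - y)) =
      ENNReal.ofReal (A * (Real.pi / b) ^ ((n : ℝ) / 2)) := by
  rw [lintegral_sub_left_eq_self (fun v => ENNReal.ofReal (gaussKernel A b t v)) x]
  exact lintegral_gaussKernel hA hb ht

/-- Hölder's inequality against the Gaussian. -/
lemma lintegral_gaussKernel_mul_le {α : ℝ} (hα : 0 < α) (hαn : α < n) (hA : 0 < A) (hb : 0 < b) :
    ∃ C : ℝ, 0 < C ∧ ∀ f : Eucl n → ℂ, AEStronglyMeasurable f volume → ∀ t : ℝ, 0 < t → ∀ x,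
      ∫⁻ y, ENNReal.ofReal (gaussKernel A b t (x - y)) * ‖f y‖ₑ ≤
        ENNReal.ofReal (C * t ^ (-α / 2)) * eLpNorm f (ENNReal.ofReal (n / α)) volume := by
  have hn : (0 : ℝ) < n := hα.trans hαn
  have hp : 1 < (n : ℝ) / α := by rwa [one_lt_div hα]
  have hpq := (Real.HolderConjugate.conjExponent hp).symm
  set p : ℝ := n / α with hpdef
  set q := p.conjExponent with hqdef
  have hq : 0 < q := hpq.pos
  -- This value of `1/q` turns the exponent `-n/2 + n/(2q)` of `t` into `-α/2`.
  have hinv : 1 / q = 1 - α / n := by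
    have := hpq.inv_add_inv_eq_one
    rw [hpdef, inv_div] at this
    rw [one_div]; linarith
  refine ⟨A * (Real.pi / (b * q)) ^ ((n : ℝ) / (2 * q)), by positivity, fun f hf t ht x => ?_⟩
  have hmeas : AEMeasurable (fun y : Eucl n => ENNReal.ofReal (gaussKernel A b t (x - y))) :=
    (measurable_gaussKernel.comp (measurable_const.sub measurable_id)).ennreal_ofReal.aemeasurable
  refine (ENNReal.lintegral_mul_le_Lp_mul_Lq volume hpq hmeas hf.enorm).trans (le_of_eq ?_)
  rw [lintegral_sub_left_eq_self (fun v => ENNReal.ofReal (gaussKernel A b t v) ^ q) x,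
    lintegral_gaussKernel_rpow hA hb ht hq,
    eLpNorm_eq_lintegral_rpow_enorm_toReal (by simpa using (zero_lt_one.trans hp))
      ENNReal.ofReal_ne_top, ENNReal.toReal_ofReal (zero_lt_one.trans hp).le]
  congr 4
  have : (n : ℝ) / (2 * q) = n / 2 * (1 / q) := by field_simp
  rw [this, hinv]
  field_simp
  ring

/-- Hölder's inequality for the mean of a convolution with the Gaussian. -/
lemma setLIntegral_gaussKernel_mul_le {α : ℝ} (hα : 0 < α) (hαn : α < n) (hA : 0 < A)
    (hb : 0 < b) {f : Eucl n → ℂ} (hf : AEStronglyMeasurable f volume) (ht : 0 < t)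
    (B : Set (Eucl n)) :
    ∫⁻ x in B, ∫⁻ y, ENNReal.ofReal (gaussKernel A b t (x - y)) * ‖f y‖ₑ ≤
      ENNReal.ofReal (A * (Real.pi / b) ^ ((n : ℝ) / 2)) * volume B ^ (1 - α / n) *
        eLpNorm f (ENNReal.ofReal (n / α)) volume := by
  have hn : (0 : ℝ) < n := hα.trans hαn
  have hp : 1 < (n : ℝ) / α := by rwa [one_lt_div hα]
  have hmg : Measurable fun w : Eucl n => ENNReal.ofReal (gaussKernel A b t w) :=
    measurable_gaussKernel.ennreal_ofReal
  -- Moving the translation onto `f` frees the Gaussian of `x`. After Tonelli, Hölder on `B` applies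
  -- to each translate of `f`, with a bound independent of the translation.
  have h1 : ∀ x : Eucl n, ∫⁻ y, ENNReal.ofReal (gaussKernel A b t (x - y)) * ‖f y‖ₑ =
      ∫⁻ w, ENNReal.ofReal (gaussKernel A b t w) * ‖f (x - w)‖ₑ := by
    intro x
    rw [← lintegral_sub_left_eq_self
      (fun w => ENNReal.ofReal (gaussKernel A b t w) * ‖f (x - w)‖ₑ) x]
    simp
  simp_rw [h1]
  rw [lintegral_lintegral_swap]
  swap
  · refine (hmg.comp measurable_snd).aemeasurable.mul ?_
    rw [Measure.restrict_prod_eq_prod_univ]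
    exact (hf.comp_quasiMeasurePreserving
      (quasiMeasurePreserving_sub volume volume)).enorm.mono_measure Measure.restrict_le_self
  have h2 : ∀ w : Eucl n, ∫⁻ x in B, ‖f (x - w)‖ₑ ≤
      volume B ^ (1 - α / n) * eLpNorm f (ENNReal.ofReal (n / α)) volume := by
    intro w
    have hmp : MeasurePreserving (fun x : Eucl n => x - w) volume volume :=
      measurePreserving_sub_right volume w
    have hfw := hf.comp_measurePreserving hmp
    have h3 := eLpNorm_le_eLpNorm_mul_rpow_measure_univ (μ := volume.restrict B) (p := 1)
      (q := ENNReal.ofReal (n / α)) (f := f ∘ fun x => x - w)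
      (by rw [ENNReal.one_le_ofReal]; exact hp.le) hfw.restrict
    rw [eLpNorm_one_eq_lintegral_enorm, ENNReal.toReal_ofReal (zero_lt_one.trans hp).le,
      Measure.restrict_apply_univ] at h3
    refine h3.trans ?_
    rw [mul_comm]
    have h4 : (1 / ENNReal.toReal 1 - 1 / ((n : ℝ) / α)) = 1 - α / n := by simp
    rw [h4]
    gcongr
    exact (eLpNorm_restrict_le _ _ _ _).trans (eLpNorm_comp_measurePreserving hf hmp).le
  calc ∫⁻ w, ∫⁻ x in B, ENNReal.ofReal (gaussKernel A b t w) * ‖f (x - w)‖ₑ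
      = ∫⁻ w, ENNReal.ofReal (gaussKernel A b t w) * ∫⁻ x in B, ‖f (x - w)‖ₑ :=
        lintegral_congr fun w => lintegral_const_mul' _ _ ENNReal.ofReal_ne_top
    _ ≤ ∫⁻ w, ENNReal.ofReal (gaussKernel A b t w) *
        (volume B ^ (1 - α / n) * eLpNorm f (ENNReal.ofReal (n / α)) volume) := by
        gcongr with w; exact h2 w
    _ = _ := by
        rw [lintegral_mul_const _ hmg, lintegral_gaussKernel hA hb ht, mul_assoc]

/-- A Gaussian times a polynomial weight is integrable. -/
lemma integrable_gaussKernel_sq_mul_weight (hb : 0 < b) (ht : 0 < t)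
    (N : ℝ) (hN : 0 ≤ N) (x : Eucl n) :
    Integrable fun y : Eucl n => gaussKernel A b t (x - y) ^ 2 * (1 + ‖y‖ ^ N) := by
  set c := b / t with hc
  have hc0 : 0 < c := by positivity
  set k := ⌈N⌉₊
  -- The squared Gaussian is at most a constant times `e^{2c|x|²} e^{-c|y|²}`. The polynomial weight
  -- costs `e^{c|y|²/2}`, which leaves `e^{-c|y|²/2}`; `K` collects the constants.
  set K : ℝ := (A / t ^ ((n : ℝ) / 2)) ^ 2 * Real.exp (2 * c * ‖x‖ ^ 2) *
    (2 * (k.factorial * (2 / c) ^ k * Real.exp (c / 2))) with hK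
  refine ((integrable_exp_neg_mul_norm_sq (n := n) (half_pos hc0)).const_mul K).mono' ?_
    (ae_of_all _ fun y => ?_)
  · have hm : Measurable fun y : Eucl n => gaussKernel A b t (x - y) ^ 2 * (1 + ‖y‖ ^ N) :=
      ((measurable_gaussKernel.comp (measurable_const.sub measurable_id)).pow_const 2).mul
        (measurable_const.add (measurable_norm.pow_const N))
    exact hm.aestronglyMeasurable
  · have hw : 1 + ‖y‖ ^ N ≤ 2 * (1 + ‖y‖ ^ 2) ^ k := by
      have h1 : (1 : ℝ) ≤ 1 + ‖y‖ ^ 2 := by nlinarith [sq_nonneg ‖y‖]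
      have h2 : ‖y‖ ≤ 1 + ‖y‖ ^ 2 := by nlinarith [sq_nonneg (‖y‖ - 1)]
      have h3 : ‖y‖ ^ N ≤ (1 + ‖y‖ ^ 2) ^ k := by
        calc ‖y‖ ^ N ≤ (1 + ‖y‖ ^ 2) ^ N := Real.rpow_le_rpow (norm_nonneg _) h2 hN
          _ ≤ (1 + ‖y‖ ^ 2) ^ (k : ℝ) := Real.rpow_le_rpow_of_exponent_le h1 (Nat.le_ceil N)
          _ = _ := Real.rpow_natCast _ _
      linarith [one_le_pow₀ h1 (n := k)]
    have hpoly : (1 + ‖y‖ ^ 2) ^ k ≤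
        k.factorial * (2 / c) ^ k * Real.exp (c / 2 * (1 + ‖y‖ ^ 2)) := by
      have h := Real.pow_div_factorial_le_exp (c / 2 * (1 + ‖y‖ ^ 2)) (by positivity) k
      rw [div_le_iff₀ (by positivity), mul_pow] at h
      have e : (2 / c) ^ k * (c / 2) ^ k = 1 := by
        rw [← mul_pow, div_mul_div_cancel₀ hc0.ne', div_self two_ne_zero, one_pow]
      calc (1 + ‖y‖ ^ 2) ^ k = (2 / c) ^ k * ((c / 2) ^ k * (1 + ‖y‖ ^ 2) ^ k) := by
            rw [← mul_assoc, e, one_mul]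
        _ ≤ (2 / c) ^ k * (Real.exp (c / 2 * (1 + ‖y‖ ^ 2)) * k.factorial) := by gcongr
        _ = _ := by ring
    have hexp : Real.exp (-b * ‖x - y‖ ^ 2 / t) ^ 2 ≤
        Real.exp (2 * c * ‖x‖ ^ 2) * Real.exp (-c * ‖y‖ ^ 2) := by
      rw [← Real.exp_nat_mul, ← Real.exp_add, Real.exp_le_exp]
      have h1 : ‖y‖ ≤ ‖x‖ + ‖x - y‖ := by
        have := norm_sub_le x (x - y); simpa using this
      have h2 : ‖y‖ ^ 2 ≤ 2 * ‖x‖ ^ 2 + 2 * ‖x - y‖ ^ 2 := by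
        nlinarith [norm_nonneg y, norm_nonneg x, norm_nonneg (x - y), sq_nonneg (‖x‖ - ‖x - y‖)]
      have h3 : -b * ‖x - y‖ ^ 2 / t = -(c * ‖x - y‖ ^ 2) := by rw [hc]; ring
      rw [h3]
      push_cast
      nlinarith
    have hg : gaussKernel A b t (x - y) ^ 2 ≤ (A / t ^ ((n : ℝ) / 2)) ^ 2 *
        (Real.exp (2 * c * ‖x‖ ^ 2) * Real.exp (-c * ‖y‖ ^ 2)) := by
      rw [gaussKernel, mul_pow]
      gcongr
    rw [Real.norm_of_nonneg (by positivity)]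
    calc gaussKernel A b t (x - y) ^ 2 * (1 + ‖y‖ ^ N)
        ≤ ((A / t ^ ((n : ℝ) / 2)) ^ 2 * (Real.exp (2 * c * ‖x‖ ^ 2) * Real.exp (-c * ‖y‖ ^ 2))) *
          (2 * (k.factorial * (2 / c) ^ k * Real.exp (c / 2 * (1 + ‖y‖ ^ 2)))) := by
          gcongr
          exact hw.trans (by gcongr)
      _ = K * Real.exp (-(c / 2) * ‖y‖ ^ 2) := by
          have e1 : Real.exp (-c * ‖y‖ ^ 2) * Real.exp (c / 2 * (1 + ‖y‖ ^ 2)) =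
              Real.exp (c / 2) * Real.exp (-(c / 2) * ‖y‖ ^ 2) := by
            rw [← Real.exp_add, ← Real.exp_add]; congr 1; ring
          rw [hK]
          linear_combination ((A / t ^ ((n : ℝ) / 2)) ^ 2 * Real.exp (2 * c * ‖x‖ ^ 2) *
            2 * (k.factorial * (2 / c) ^ k)) * e1

end Gaussian

/-! ### The difference of the time weights and its scale-invariant mass -/

/-- `t^a` for `t > 0`, extended by zero. -/
noncomputable def posPow (a t : ℝ) : ℝ := (Ioi (0 : ℝ)).indicator (fun s => s ^ a) t

section Weight

variable {a : ℝ}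

lemma posPow_of_pos {t : ℝ} (ht : 0 < t) : posPow a t = t ^ a := indicator_of_mem (mem_Ioi.2 ht) _

lemma posPow_of_nonpos {t : ℝ} (ht : t ≤ 0) : posPow a t = 0 :=
  indicator_of_notMem (notMem_Ioi.2 ht) _

lemma measurable_posPow : Measurable (posPow a) :=
  (measurable_id.pow_const a).indicator measurableSet_Ioi

lemma posPow_mul {h : ℝ} (hh : 0 < h) (s : ℝ) : posPow a (h * s) = h ^ a * posPow a s := by
  rcases le_or_gt s 0 with hs | hs
  · rw [posPow_of_nonpos hs, posPow_of_nonpos (mul_nonpos_of_nonneg_of_nonpos hh.le hs), mul_zero]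
  · rw [posPow_of_pos hs, posPow_of_pos (mul_pos hh hs), Real.mul_rpow hh.le hs.le]

lemma integrableOn_posPow (ha : -1 < a) (R : ℝ) : IntegrableOn (posPow a) (Iic R) := by
  rcases le_or_gt R 0 with hR | hR
  · refine (integrableOn_zero).congr_fun (fun t ht => ?_) measurableSet_Iic
    exact (posPow_of_nonpos (le_trans ht hR)).symm
  · have h1 : IntegrableOn (posPow a) (Iic 0) := by
      refine (integrableOn_zero).congr_fun (fun t ht => ?_) measurableSet_Iic
      exact (posPow_of_nonpos ht).symm
    have h2 : IntegrableOn (posPow a) (Ioc 0 R) := by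
      rw [integrableOn_Ioc_iff_integrableOn_Ioo]
      refine ((intervalIntegral.integrableOn_Ioo_rpow_iff hR).2 ha).congr_fun (fun t ht => ?_)
        measurableSet_Ioo
      exact (posPow_of_pos ht.1).symm
    rw [← Iic_union_Ioc_eq_Iic hR.le]
    exact h1.union h2

/-- Mean value inequality on `[s-1, s]`. Since `s > 2`, points of this interval are comparable to
`s` up to a factor `2`, whatever the sign of `a - 1`. -/
lemma abs_rpow_sub_rpow_le {s : ℝ} (hs : 2 < s) :
    |s ^ a - (s - 1) ^ a| ≤ |a| * 2 ^ |a - 1| * s ^ (a - 1) := by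
  have h := Convex.norm_image_sub_le_of_norm_hasDerivWithin_le (f := fun x : ℝ => x ^ a)
    (f' := fun x => a * x ^ (a - 1)) (s := Icc (s - 1) s) (x := s - 1) (y := s)
    (C := |a| * 2 ^ |a - 1| * s ^ (a - 1)) ?_ ?_ (convex_Icc _ _) ⟨le_rfl, by linarith⟩
    ⟨by linarith, le_rfl⟩
  · simpa using h
  · intro x hx
    exact (Real.hasDerivAt_rpow_const (Or.inl (by linarith [hx.1]))).hasDerivWithinAt
  · intro x hx
    have hx0 : 0 < x := by linarith [hx.1]
    have hs0 : 0 < s := by linarith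
    rw [norm_mul, Real.norm_eq_abs, Real.norm_of_nonneg (by positivity), mul_assoc]
    gcongr
    have hq1 : x / s ≤ 1 := (div_le_one hs0).2 hx.2
    have hq2 : 1 / 2 ≤ x / s := by rw [div_le_div_iff₀ two_pos hs0]; linarith [hx.1]
    have e : x ^ (a - 1) = (x / s) ^ (a - 1) * s ^ (a - 1) := by
      rw [← Real.mul_rpow (by positivity) hs0.le, div_mul_cancel₀ _ hs0.ne']
    rw [e]
    gcongr
    calc (x / s) ^ (a - 1) ≤ (x / s) ^ (-|a - 1|) :=
          Real.rpow_le_rpow_of_exponent_ge (by positivity) hq1 (neg_abs_le _)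
      _ ≤ (1 / 2) ^ (-|a - 1|) :=
          Real.rpow_le_rpow_of_nonpos (by norm_num) hq2 (by simp)
      _ = 2 ^ |a - 1| := by rw [one_div, Real.inv_rpow two_pos.le, Real.rpow_neg two_pos.le, inv_inv]

/-- The total mass of the difference of the two time weights against `min (1, s^{-(a+1)})`. -/
noncomputable def weightMass (a : ℝ) : ℝ≥0∞ :=
  ∫⁻ s : ℝ, ‖posPow a s - posPow a (s - 1)‖ₑ * ENNReal.ofReal (min 1 (s ^ (-(a + 1))))

/-- Up to `s = 2` the minimum is at most `1` and both weights are integrable. Beyond, the integrand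
is at most a multiple of `s^{a-1} s^{-(a+1)} = s^{-2}`. -/
lemma weightMass_lt_top (ha : -1 < a) : weightMass a < ⊤ := by
  rw [weightMass, ← lintegral_add_compl _ (measurableSet_Iic (a := (2 : ℝ)))]
  refine ENNReal.add_lt_top.2 ⟨?_, ?_⟩
  · have hi : IntegrableOn (fun s => posPow a s - posPow a (s - 1)) (Iic 2) := by
      refine (integrableOn_posPow ha 2).sub ?_
      have h1 : IntegrableOn (posPow a) (Iic 1) := integrableOn_posPow ha 1
      have hmp : MeasurePreserving (fun s : ℝ => s - 1) volume volume :=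
        measurePreserving_sub_right volume 1
      have := (hmp.integrableOn_comp_preimage (measurableEmbedding_subRight 1)
        (f := posPow a) (s := Iic 1)).2 h1
      have e : (fun s : ℝ => s - 1) ⁻¹' Iic 1 = Iic 2 := by
        ext s
        simp only [mem_preimage, mem_Iic]
        constructor <;> intro h <;> linarith
      rw [e] at this
      exact this
    refine lt_of_le_of_lt ?_ hi.2
    refine lintegral_mono fun s => ?_
    refine mul_le_of_le_one_right' ?_
    rw [ENNReal.ofReal_le_one]
    exact min_le_left _ _
  · rw [compl_Iic]
    have hi : IntegrableOn (fun s : ℝ => |a| * 2 ^ |a - 1| * s ^ (-2 : ℝ)) (Ioi 2) :=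
      (integrableOn_Ioi_rpow_of_lt (by norm_num) two_pos).const_mul _
    refine lt_of_le_of_lt ?_ hi.2
    refine setLIntegral_mono_ae' measurableSet_Ioi (ae_of_all _ fun s hs => ?_)
    have hs : 2 < s := hs
    have hs0 : 0 < s := by linarith
    rw [← ofReal_norm, ← ofReal_norm, ← ENNReal.ofReal_mul (norm_nonneg _)]
    refine ENNReal.ofReal_le_ofReal ?_
    rw [posPow_of_pos hs0, posPow_of_pos (by linarith : 0 < s - 1), Real.norm_eq_abs]
    refine le_trans ?_ (le_abs_self _)
    calc |s ^ a - (s - 1) ^ a| * min 1 (s ^ (-(a + 1)))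
        ≤ (|a| * 2 ^ |a - 1| * s ^ (a - 1)) * s ^ (-(a + 1)) := by
          gcongr
          · exact abs_rpow_sub_rpow_le hs
          · exact min_le_right _ _
      _ = _ := by
          rw [mul_assoc, ← Real.rpow_add hs0]
          congr 2; ring

lemma lintegral_comp_mul_pos (φ : ℝ → ℝ≥0∞) {h : ℝ} (hh : 0 < h) :
    ∫⁻ t, φ t = ENNReal.ofReal h * ∫⁻ s, φ (h * s) := by
  have e := lintegral_map_equiv (μ := volume) φ (Homeomorph.mulLeft₀ h hh.ne').toMeasurableEquiv
  have e2 : Measure.map (Homeomorph.mulLeft₀ h hh.ne').toMeasurableEquiv (volume : Measure ℝ) =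
      ENNReal.ofReal |h⁻¹| • volume := Real.map_volume_mul_left hh.ne'
  rw [e2, lintegral_smul_measure, abs_of_pos (inv_pos.2 hh)] at e
  have e3 : ∫⁻ s, φ (h * s) = ENNReal.ofReal h⁻¹ * ∫⁻ t, φ t := e.symm
  rw [e3, ← mul_assoc, ← ENNReal.ofReal_mul hh.le, mul_inv_cancel₀ hh.ne', ENNReal.ofReal_one,
    one_mul]

/-- Substituting `t = h s`, the factors are `h` from `dt`, `h^a` from the weights and `h^{-(a+1)}`
from the minimum, and they cancel. This is why the final constant does not depend on the radius. -/
lemma lintegral_weight_scaled {h : ℝ} (hh : 0 < h) :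
    ∫⁻ t : ℝ, ‖posPow a t - posPow a (t - h)‖ₑ *
      ENNReal.ofReal (min (h ^ (-(a + 1))) (t ^ (-(a + 1)))) = weightMass a := by
  rw [lintegral_comp_mul_pos _ hh, weightMass, ← lintegral_const_mul' _ _ ENNReal.ofReal_ne_top]
  refine lintegral_congr fun s => ?_
  have e1 : h * s - h = h * (s - 1) := by ring
  rw [e1, posPow_mul hh, posPow_mul hh, ← mul_sub]
  rcases le_or_gt s 0 with hs | hs
  · rw [posPow_of_nonpos hs, posPow_of_nonpos (by linarith : s - 1 ≤ 0)]; simp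
  · rw [← ofReal_norm, ← ofReal_norm, ← ENNReal.ofReal_mul (norm_nonneg _),
      ← ENNReal.ofReal_mul (norm_nonneg _), ← ENNReal.ofReal_mul hh.le, Real.mul_rpow hh.le hs.le,
      norm_mul, Real.norm_of_nonneg (Real.rpow_nonneg hh.le a)]
    congr 1
    have e2 : min (h ^ (-(a + 1))) (h ^ (-(a + 1)) * s ^ (-(a + 1))) =
        h ^ (-(a + 1)) * min 1 (s ^ (-(a + 1))) := by
      rw [mul_min_of_nonneg _ _ (by positivity), mul_one]
    have e3 : h * h ^ a * h ^ (-(a + 1)) = 1 := by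
      rw [neg_add, Real.rpow_add hh, Real.rpow_neg hh.le, Real.rpow_neg hh.le, Real.rpow_one]
      field_simp
    rw [e2]
    linear_combination (‖posPow a s - posPow a (s - 1)‖ * min 1 (s ^ (-(a + 1)))) * e3

end Weight

/-! ### The semigroup on `L^{n/α}` -/

section Heat

variable {n : ℕ} {A b : ℝ} {p : ℝ → Eucl n → Eucl n → ℂ} {f : Eucl n → ℂ}

lemma GaussianBound.enorm_le (hG : GaussianBound A b p) {t : ℝ} (ht : 0 < t) (x y : Eucl n) :
    ‖p t x y‖ₑ ≤ ENNReal.ofReal (gaussKernel A b t (x - y)) := by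
  rw [← ofReal_norm]
  exact ENNReal.ofReal_le_ofReal (hG t ht x y)

lemma heatApply_congr {g : Eucl n → ℂ} (h : f =ᵐ[volume] g) (t : ℝ) :
    heatApply p t f = heatApply p t g := by
  funext x
  exact integral_congr_ae (h.mono fun y hy => by simp only [hy])

lemma measurable_heatApply
    (hp : Measurable fun q : ℝ × Eucl n × Eucl n => p q.1 q.2.1 q.2.2)
    (hf : AEStronglyMeasurable f volume) :
    Measurable fun q : ℝ × Eucl n => heatApply p q.1 f q.2 := by
  have e : (fun q : ℝ × Eucl n => heatApply p q.1 f q.2) =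
      fun q : ℝ × Eucl n => ∫ y, p q.1 q.2 y * hf.mk f y := by
    funext q
    rw [heatApply_congr hf.ae_eq_mk]
    rfl
  rw [e]
  refine (StronglyMeasurable.integral_prod_right (ν := (volume : Measure (Eucl n)))
    (f := fun (q : ℝ × Eucl n) (y : Eucl n) => p q.1 q.2 y * hf.mk f y) ?_).measurable
  refine Measurable.stronglyMeasurable ?_
  refine Measurable.mul ?_ (hf.stronglyMeasurable_mk.measurable.comp measurable_snd)
  exact hp.comp (measurable_fst.fst.prodMk (measurable_fst.snd.prodMk measurable_snd))

lemma measurable_kernel_right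
    (hp : Measurable fun q : ℝ × Eucl n × Eucl n => p q.1 q.2.1 q.2.2) (t : ℝ) (x : Eucl n) :
    Measurable (p t x) :=
  hp.comp (measurable_const.prodMk (measurable_const.prodMk measurable_id))

lemma lintegral_kernel_mul_le (hG : GaussianBound A b p) {t : ℝ} (ht : 0 < t) (x : Eucl n)
    (g : Eucl n → ℂ) :
    ∫⁻ y, ‖p t x y * g y‖ₑ ≤
      ∫⁻ y, ENNReal.ofReal (gaussKernel A b t (x - y)) * ‖g y‖ₑ := by
  refine lintegral_mono fun y => ?_
  rw [enorm_mul]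
  gcongr
  exact hG.enorm_le ht x y

lemma enorm_heatApply_le (hG : GaussianBound A b p) {t : ℝ} (ht : 0 < t) (x : Eucl n) :
    ‖heatApply p t f x‖ₑ ≤ ∫⁻ y, ENNReal.ofReal (gaussKernel A b t (x - y)) * ‖f y‖ₑ :=
  (enorm_integral_le_lintegral_enorm _).trans (lintegral_kernel_mul_le hG ht x f)

/-- The positive half-line lies in every sector, so the law there restricts to it. -/
lemma IsAnalyticSemigroup.map_add {H : Type*} [NormedAddCommGroup H] [NormedSpace ℂ H]
    {T : ℝ → H →L[ℂ] H} (hT : IsAnalyticSemigroup T) {s t : ℝ} (hs : 0 < s) (ht : 0 < t) :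
    T (s + t) = (T s).comp (T t) := by
  obtain ⟨θ, hθ, -, S, -, -, hadd, -, hS⟩ := hT
  have hmem : ∀ r : ℝ, 0 < r → (r : ℂ) ∈ openSector θ := fun r hr =>
    ⟨by exact_mod_cast hr.ne', by rwa [Complex.arg_ofReal_of_nonneg hr.le, abs_zero]⟩
  rw [hS _ (add_pos hs ht).le, hS _ hs.le, hS _ ht.le, Complex.ofReal_add,
    hadd _ (hmem s hs) _ (hmem t ht)]

variable {T : ℝ → L2Space n →L[ℂ] L2Space n}

/-- The semigroup law for the kernels, on square integrable functions. -/
lemma heatApply_heatApply_of_memLp_two (hT : IsAnalyticSemigroup T) (hK : IsSemigroupKernel T p)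
    (hf : MemLp f 2 volume) {s t : ℝ} (hs : 0 < s) (ht : 0 < t) :
    heatApply p s (heatApply p t f) =ᵐ[volume] heatApply p (s + t) f := by
  set v : L2Space n := hf.toLp f
  have hrep : ∀ r : ℝ, 0 < r → ∀ u : L2Space n, (T r u : Eucl n → ℂ) =ᵐ[volume] heatApply p r u :=
    hK.represents
  have hv : ∀ r : ℝ, heatApply p r v = heatApply p r f := heatApply_congr hf.coeFn_toLp
  have h1 := hrep t ht v
  rw [hv] at h1
  have h2 := hrep s hs (T t v)
  rw [heatApply_congr h1] at h2
  have h3 := hrep (s + t) (add_pos hs ht) v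
  rw [hv, hT.map_add hs ht] at h3
  exact h2.symm.trans h3

/-- The restriction of a function to the part of the ball of radius `k` where its norm is at
most `k`. -/
noncomputable def truncate (f : Eucl n → ℂ) (k : ℕ) : Eucl n → ℂ :=
  {x | ‖x‖ ≤ k ∧ ‖f x‖ ≤ k}.indicator f

lemma norm_truncate_le (f : Eucl n → ℂ) (k : ℕ) (x : Eucl n) : ‖truncate f k x‖ ≤ ‖f x‖ :=
  norm_indicator_le_norm_self _ _

lemma tendsto_truncate (f : Eucl n → ℂ) (x : Eucl n) :
    Tendsto (fun k => truncate f k x) atTop (𝓝 (f x)) := by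
  refine tendsto_const_nhds.congr' ?_
  filter_upwards [eventually_ge_atTop ⌈max ‖x‖ ‖f x‖⌉₊] with k hk
  have hk' : max ‖x‖ ‖f x‖ ≤ k := Nat.ceil_le.1 hk
  have hx : x ∈ {x | ‖x‖ ≤ k ∧ ‖f x‖ ≤ k} :=
    ⟨(le_max_left _ _).trans hk', (le_max_right _ _).trans hk'⟩
  exact (indicator_of_mem hx f).symm

lemma measurable_truncate (hf : Measurable f) (k : ℕ) : Measurable (truncate f k) :=
  hf.indicator ((measurableSet_le measurable_norm measurable_const).inter
    (measurableSet_le hf.norm measurable_const))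

/-- Bounded with bounded support. With `q = 2` this brings the truncations into the space where the
kernels are known to compose. -/
lemma memLp_truncate (hf : Measurable f) (k : ℕ) (q : ℝ≥0∞) : MemLp (truncate f k) q volume := by
  have hS : MeasurableSet {x : Eucl n | ‖x‖ ≤ k ∧ ‖f x‖ ≤ k} :=
    (measurableSet_le measurable_norm measurable_const).inter
      (measurableSet_le hf.norm measurable_const)
  rw [truncate, memLp_indicator_iff_restrict hS]
  have hfin : volume {x : Eucl n | ‖x‖ ≤ k ∧ ‖f x‖ ≤ k} < ⊤ :=
    lt_of_le_of_lt (measure_mono fun x hx => mem_closedBall_zero_iff.2 hx.1)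
      (measure_closedBall_lt_top (x := (0 : Eucl n)) (r := k))
  have : IsFiniteMeasure (volume.restrict {x : Eucl n | ‖x‖ ≤ k ∧ ‖f x‖ ≤ k}) :=
    ⟨by rwa [Measure.restrict_apply_univ]⟩
  refine MemLp.of_bound hf.aestronglyMeasurable k ?_
  exact (ae_restrict_mem hS).mono fun x hx => hx.2

lemma integrable_kernel_mul (hK : IsSemigroupKernel T p) (hG : GaussianBound A b p) {α : ℝ}
    (hα : 0 < α) (hαn : α < n) (hA : 0 < A) (hb : 0 < b)
    (hf : MemLp f (ENNReal.ofReal (n / α)) volume) {t : ℝ} (ht : 0 < t) (x : Eucl n) :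
    Integrable fun y => p t x y * f y := by
  refine ⟨(measurable_kernel_right hK.measurable t x).aestronglyMeasurable.mul hf.1, ?_⟩
  obtain ⟨C, -, hC⟩ := lintegral_gaussKernel_mul_le (n := n) hα hαn hA hb
  refine (lintegral_kernel_mul_le hG ht x f).trans_lt ((hC f hf.1 t ht x).trans_lt ?_)
  exact ENNReal.mul_lt_top ENNReal.ofReal_lt_top hf.2

lemma integrable_gaussKernel_sub (hA : 0 < A) (hb : 0 < b) {t : ℝ} (ht : 0 < t) (x : Eucl n) :
    Integrable fun y : Eucl n => gaussKernel A b t (x - y) := by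
  refine ⟨(measurable_gaussKernel.comp
    (measurable_const.sub measurable_id)).aestronglyMeasurable, ?_⟩
  have h := lintegral_gaussKernel_sub_left x hA hb ht
  have e : ∀ y, ‖gaussKernel A b t (x - y)‖ₑ = ENNReal.ofReal (gaussKernel A b t (x - y)) :=
    fun y => Real.enorm_of_nonneg (gaussKernel_nonneg hA ht _)
  simp only [HasFiniteIntegral, e, h, ENNReal.ofReal_lt_top]

/-- The semigroup law for the kernels, on `L^{n/α}`. -/
lemma heatApply_heatApply (hT : IsAnalyticSemigroup T) (hK : IsSemigroupKernel T p)
    (hG : GaussianBound A b p) {α : ℝ} (hα : 0 < α) (hαn : α < n) (hA : 0 < A) (hb : 0 < b)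
    (hf : MemLp f (ENNReal.ofReal (n / α)) volume) {s t : ℝ} (hs : 0 < s) (ht : 0 < t) :
    heatApply p s (heatApply p t f) =ᵐ[volume] heatApply p (s + t) f := by
  -- A measurable representative makes the truncation sets measurable.
  wlog hfm : Measurable f generalizing f
  · have h := this (f := hf.1.mk f) (hf.ae_eq hf.1.ae_eq_mk) hf.1.stronglyMeasurable_mk.measurable
    rwa [← heatApply_congr hf.1.ae_eq_mk, ← heatApply_congr hf.1.ae_eq_mk] at h
  have hlim : ∀ r : ℝ, 0 < r → ∀ x,
      Tendsto (fun k => heatApply p r (truncate f k) x) atTop (𝓝 (heatApply p r f x)) := by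
    intro r hr x
    refine tendsto_integral_of_dominated_convergence (fun y => ‖p r x y * f y‖) (fun k => ?_)
      (integrable_kernel_mul hK hG hα hαn hA hb hf hr x).norm (fun k => ae_of_all _ fun y => ?_)
      (ae_of_all _ fun y => (tendsto_truncate f y).const_mul _)
    · exact ((measurable_kernel_right hK.measurable r x).mul
        (measurable_truncate hfm k)).aestronglyMeasurable
    · rw [norm_mul, norm_mul]
      gcongr
      exact norm_truncate_le f k y
  obtain ⟨C, -, hC⟩ := lintegral_gaussKernel_mul_le (n := n) hα hαn hA hb
  set D : ℝ≥0∞ := ENNReal.ofReal (C * t ^ (-α / 2)) * eLpNorm f (ENNReal.ofReal (n / α)) volume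
  have hD : D < ⊤ := ENNReal.mul_lt_top ENNReal.ofReal_lt_top hf.2
  -- A bound uniform in `k` and `x`: multiplied by the Gaussian at time `s`, it dominates the outer
  -- integrals in the limit of the truncations.
  have hbound : ∀ k x, ‖heatApply p t (truncate f k) x‖ ≤ D.toReal := by
    intro k x
    have h : ‖heatApply p t (truncate f k) x‖ₑ ≤ D := by
      refine (enorm_heatApply_le hG ht x).trans (le_trans (lintegral_mono fun y => ?_)
        (hC f hf.1 t ht x))
      gcongr
      rw [← ofReal_norm, ← ofReal_norm]
      exact ENNReal.ofReal_le_ofReal (norm_truncate_le f k y)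
    rw [← toReal_enorm]
    exact ENNReal.toReal_mono hD.ne h
  have hlaw : ∀ᵐ x, ∀ k, heatApply p s (heatApply p t (truncate f k)) x =
      heatApply p (s + t) (truncate f k) x :=
    ae_all_iff.2 fun k => heatApply_heatApply_of_memLp_two hT hK (memLp_truncate hfm k 2) hs ht
  filter_upwards [hlaw] with x hx
  refine tendsto_nhds_unique ?_ (hlim (s + t) (add_pos hs ht) x)
  simp only [← hx]
  refine tendsto_integral_of_dominated_convergence
    (fun y => gaussKernel A b s (x - y) * D.toReal) (fun k => ?_)
    ((integrable_gaussKernel_sub hA hb hs x).mul_const _) (fun k => ae_of_all _ fun y => ?_)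
    (ae_of_all _ fun y => (hlim t ht y).const_mul _)
  · exact ((measurable_kernel_right hK.measurable s x).mul
      ((measurable_heatApply hK.measurable (measurable_truncate hfm k).aestronglyMeasurable).comp
        (measurable_const.prodMk measurable_id))).aestronglyMeasurable
  · rw [norm_mul]
    exact mul_le_mul (hG s hs x y) (hbound k y) (norm_nonneg _) (gaussKernel_nonneg hA hs _)

/-- The mean of `|e^{-tL} f|` over a ball of radius `r`. -/
lemma ballMean_heatApply_le {α : ℝ} (hα : 0 < α) (hαn : α < n) (hA : 0 < A) (hb : 0 < b) :
    ∃ C : ℝ, 0 < C ∧ ∀ p : ℝ → Eucl n → Eucl n → ℂ, GaussianBound A b p →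
      ∀ f : Eucl n → ℂ, AEStronglyMeasurable f volume → ∀ t : ℝ, 0 < t →
      (∀ x, ‖heatApply p t f x‖ₑ ≤
        ENNReal.ofReal (C * t ^ (-(α / 2))) * eLpNorm f (ENNReal.ofReal (n / α)) volume) ∧
      ∀ (r : ℝ) (y : Eucl n), 0 < r → ballMean y r (heatApply p t f) ≤
        ENNReal.ofReal (C * min ((r ^ 2) ^ (-(α / 2))) (t ^ (-(α / 2)))) *
          eLpNorm f (ENNReal.ofReal (n / α)) volume := by
  have hn : (0 : ℝ) < n := hα.trans hαn
  have : Nonempty (Fin n) := ⟨⟨0, by exact_mod_cast hn⟩⟩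
  obtain ⟨C₁, hC₁, h₁⟩ := lintegral_gaussKernel_mul_le (n := n) hα hαn hA hb
  set ω : ℝ := (volume (Metric.ball (0 : Eucl n) 1)).toReal with hω
  have hω0 : 0 < ω := ENNReal.toReal_pos (Metric.measure_ball_pos _ _ one_pos).ne'
    measure_ball_lt_top.ne
  -- Averaging the Hölder bound leaves `|B|^{-α/n} = (ω r^n)^{-α/n} = ω^{-α/n} (r²)^{-α/2}`.
  set C₂ : ℝ := A * (Real.pi / b) ^ ((n : ℝ) / 2) * ω ^ (-(α / n)) with hC₂
  refine ⟨max C₁ C₂, lt_max_of_lt_left hC₁, fun p hG f hf t ht => ?_⟩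
  have hpt : ∀ x, ‖heatApply p t f x‖ₑ ≤
      ENNReal.ofReal (max C₁ C₂ * t ^ (-(α / 2))) *
        eLpNorm f (ENNReal.ofReal (n / α)) volume := fun x => by
    refine (enorm_heatApply_le hG ht x).trans ((h₁ f hf t ht x).trans ?_)
    rw [neg_div]
    gcongr
    exact le_max_left _ _
  refine ⟨hpt, fun r y hr => ?_⟩
  have hV0 : volume (Metric.ball y r) ≠ 0 := (Metric.measure_ball_pos _ _ hr).ne'
  have hVt : volume (Metric.ball y r) ≠ ⊤ := measure_ball_lt_top.ne
  rw [mul_min_of_nonneg _ _ (le_max_of_le_left hC₁.le)]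
  rcases min_choice (max C₁ C₂ * (r ^ 2) ^ (-(α / 2))) (max C₁ C₂ * t ^ (-(α / 2))) with h | h
  · rw [h, ballMean]
    have hV : volume (Metric.ball y r) = ENNReal.ofReal (r ^ n * ω) := by
      rw [Measure.addHaar_ball _ _ hr.le, ENNReal.ofReal_mul (by positivity), hω,
        ENNReal.ofReal_toReal measure_ball_lt_top.ne]
      simp
    calc (volume (Metric.ball y r))⁻¹ * ∫⁻ x in Metric.ball y r, ‖heatApply p t f x‖ₑ
        ≤ (volume (Metric.ball y r))⁻¹ *
          (ENNReal.ofReal (A * (Real.pi / b) ^ ((n : ℝ) / 2)) *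
            volume (Metric.ball y r) ^ (1 - α / n) *
            eLpNorm f (ENNReal.ofReal (n / α)) volume) := by
          gcongr
          exact (lintegral_mono fun x => enorm_heatApply_le hG ht x).trans
            (setLIntegral_gaussKernel_mul_le hα hαn hA hb hf ht _)
      _ = ENNReal.ofReal (A * (Real.pi / b) ^ ((n : ℝ) / 2)) *
          (volume (Metric.ball y r)) ^ (-(α / n)) *
            eLpNorm f (ENNReal.ofReal (n / α)) volume := by
          have e : (volume (Metric.ball y r)) ^ (-(α / n)) = (volume (Metric.ball y r))⁻¹ *
              volume (Metric.ball y r) ^ (1 - α / n) := by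
            rw [← ENNReal.rpow_neg_one, ← ENNReal.rpow_add _ _ hV0 hVt]
            congr 1; ring
          rw [e]; ring
      _ = ENNReal.ofReal (C₂ * (r ^ 2) ^ (-(α / 2))) *
            eLpNorm f (ENNReal.ofReal (n / α)) volume := by
          rw [hV, ENNReal.ofReal_rpow_of_pos (by positivity), ← ENNReal.ofReal_mul (by positivity),
            hC₂]
          congr 2
          rw [Real.mul_rpow (by positivity) hω0.le, ← Real.rpow_natCast r n, ← Real.rpow_mul hr.le,
            ← Real.rpow_natCast r 2, ← Real.rpow_mul hr.le]
          have e : (n : ℝ) * -(α / n) = ((2 : ℕ) : ℝ) * -(α / 2) := by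
            push_cast; field_simp
          rw [e]; ring
      _ ≤ _ := by
          gcongr
          exact le_max_right _ _
  · rw [h, ballMean]
    calc (volume (Metric.ball y r))⁻¹ * ∫⁻ x in Metric.ball y r, ‖heatApply p t f x‖ₑ
        ≤ (volume (Metric.ball y r))⁻¹ * ∫⁻ x in Metric.ball y r,
          ENNReal.ofReal (max C₁ C₂ * t ^ (-(α / 2))) *
            eLpNorm f (ENNReal.ofReal (n / α)) volume := by
          gcongr with x
          exact hpt x
      _ = _ := by
          rw [setLIntegral_const, mul_comm, mul_assoc, ENNReal.mul_inv_cancel hV0 hVt, mul_one]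

end Heat

/-! ### Half-line integrals as integrals over the whole line -/

section PosPow

variable {E : Type*} [NormedAddCommGroup E] [NormedSpace ℝ E] {a : ℝ}

lemma posPow_smul_eq_indicator (φ : ℝ → E) :
    (fun t => posPow a t • φ t) = (Ioi (0 : ℝ)).indicator fun t => (t ^ a : ℝ) • φ t := by
  funext t
  rw [posPow, indicator_smul_apply_left]

lemma integral_Ioi_rpow_smul (φ : ℝ → E) :
    ∫ t in Ioi (0 : ℝ), (t ^ a : ℝ) • φ t = ∫ t, posPow a t • φ t := by
  rw [posPow_smul_eq_indicator, integral_indicator measurableSet_Ioi]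

lemma integrableOn_Ioi_rpow_smul_iff (φ : ℝ → E) :
    IntegrableOn (fun t : ℝ => (t ^ a : ℝ) • φ t) (Ioi 0) ↔
      Integrable fun t => posPow a t • φ t := by
  rw [posPow_smul_eq_indicator, integrable_indicator_iff measurableSet_Ioi]

lemma lintegral_Ioi_rpow_mul (φ : ℝ → ℝ≥0∞) :
    ∫⁻ t in Ioi (0 : ℝ), ENNReal.ofReal (t ^ a) * φ t = ∫⁻ t, ‖posPow a t‖ₑ * φ t := by
  rw [← lintegral_indicator measurableSet_Ioi]
  refine lintegral_congr fun t => ?_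
  rcases le_or_gt t 0 with ht | ht
  · rw [posPow_of_nonpos ht, indicator_of_notMem (notMem_Ioi.2 ht)]; simp
  · rw [posPow_of_pos ht, indicator_of_mem (mem_Ioi.2 ht),
      Real.enorm_of_nonneg (Real.rpow_nonneg ht.le _)]

end PosPow

/-! ### The fractional integral: oscillation, and commutation with the semigroup -/

section FracPow

variable {n : ℕ} {A b α : ℝ} {p : ℝ → Eucl n → Eucl n → ℂ} {f : Eucl n → ℂ}
  {T : ℝ → L2Space n →L[ℂ] L2Space n}

lemma fracPow_eq (x : Eucl n) : fracPow p α f x =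
    ((Real.Gamma (α / 2))⁻¹ : ℝ) • ∫ t, posPow (α / 2 - 1) t • heatApply p t f x := by
  rw [fracPow, integral_Ioi_rpow_smul]

/-- Shifting time by `s` moves the shift from the semigroup to the weight, so that this integral and
the one in `fracPow_eq` differ only in their weights. -/
lemma heatFracPow_eq (s : ℝ) (x : Eucl n) : heatFracPow p α s f x =
    ((Real.Gamma (α / 2))⁻¹ : ℝ) •
      ∫ t, posPow (α / 2 - 1) (t - s) • heatApply p t f x := by
  rw [heatFracPow, integral_Ioi_rpow_smul (fun t => heatApply p (t + s) f x),
    ← integral_sub_right_eq_self _ s]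
  simp

lemma fracPowAbs_eq (x : Eucl n) : fracPowAbs p α f x =
    ENNReal.ofReal (Real.Gamma (α / 2))⁻¹ *
      ∫⁻ t, ‖posPow (α / 2 - 1) t‖ₑ * ‖heatApply p t f x‖ₑ := by
  rw [fracPowAbs, lintegral_Ioi_rpow_mul]

lemma lintegral_lt_top_of_fracPowAbs_lt_top (hα : 0 < α) {x : Eucl n}
    (h : fracPowAbs p α f x < ⊤) :
    ∫⁻ t, ‖posPow (α / 2 - 1) t‖ₑ * ‖heatApply p t f x‖ₑ < ⊤ := by
  rw [fracPowAbs_eq] at h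
  refine lt_of_le_of_ne le_top fun htop => ?_
  rw [htop, ENNReal.mul_top] at h
  · exact lt_irrefl _ h
  · have := Real.Gamma_pos_of_pos (half_pos hα)
    simpa using this

lemma enorm_fracPow_le (hα : 0 < α) (x : Eucl n) : ‖fracPow p α f x‖ₑ ≤ fracPowAbs p α f x := by
  have hΓ := Real.Gamma_pos_of_pos (half_pos hα)
  rw [fracPow_eq, fracPowAbs_eq, enorm_smul, Real.enorm_of_nonneg (inv_pos.2 hΓ).le]
  gcongr
  refine (enorm_integral_le_lintegral_enorm _).trans (le_of_eq ?_)
  simp only [enorm_smul]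

lemma measurable_fracPow
    (hp : Measurable fun q : ℝ × Eucl n × Eucl n => p q.1 q.2.1 q.2.2)
    (hf : AEStronglyMeasurable f volume) : Measurable (fracPow p α f) := by
  have hm : StronglyMeasurable (Function.uncurry fun (x : Eucl n) (t : ℝ) =>
      posPow (α / 2 - 1) t • heatApply p t f x) :=
    ((measurable_posPow.comp measurable_snd).smul
      ((measurable_heatApply hp hf).comp measurable_swap)).stronglyMeasurable
  have h := (hm.integral_prod_right (ν := (volume : Measure ℝ))).measurable.const_smul
    ((Real.Gamma (α / 2))⁻¹ : ℝ)
  convert h using 1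
  funext x
  exact fracPow_eq x

lemma measurable_heatApply_left
    (hp : Measurable fun q : ℝ × Eucl n × Eucl n => p q.1 q.2.1 q.2.2)
    (hf : AEStronglyMeasurable f volume) (x : Eucl n) : Measurable fun t => heatApply p t f x :=
  (measurable_heatApply hp hf).comp (measurable_id.prodMk measurable_const)

/-- The translated weight is integrable against `e^{-tL} f (x)` if the weight itself is. -/
lemma integrable_posPow_sub_smul_heatApply
    (hp : Measurable fun q : ℝ × Eucl n × Eucl n => p q.1 q.2.1 q.2.2)
    (hα : 0 < α) (hf : MemLp f (ENNReal.ofReal (n / α)) volume) {C : ℝ} (hC0 : 0 < C) {x : Eucl n}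
    (hC : ∀ t : ℝ, 0 < t → ‖heatApply p t f x‖ₑ ≤
      ENNReal.ofReal (C * t ^ (-(α / 2))) * eLpNorm f (ENNReal.ofReal (n / α)) volume)
    (hx : ∫⁻ t, ‖posPow (α / 2 - 1) t‖ₑ * ‖heatApply p t f x‖ₑ < ⊤) {h : ℝ} (hh : 0 < h) :
    Integrable fun t => posPow (α / 2 - 1) (t - h) • heatApply p t f x := by
  set a := α / 2 - 1 with ha
  have ha' : -(a + 1) = -(α / 2) := by rw [ha]; ring
  have hW := weightMass_lt_top (a := a) (by rw [ha]; linarith)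
  have hmu := measurable_heatApply_left hp hf.1 x
  refine ⟨((measurable_posPow.comp (measurable_id.sub_const h)).smul hmu).aestronglyMeasurable, ?_⟩
  -- The shifted weight is at most the original one plus their difference. It is supported in `t >
  -- h`, where the minimum is `t^{-α/2}`, so the pointwise bound is enough and no averaging is
  -- needed.
  have hle : ∀ t, ‖posPow a (t - h) • heatApply p t f x‖ₑ ≤
      ‖posPow a t‖ₑ * ‖heatApply p t f x‖ₑ +
      ‖posPow a t - posPow a (t - h)‖ₑ *
        ENNReal.ofReal (min (h ^ (-(a + 1))) (t ^ (-(a + 1)))) *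
        (ENNReal.ofReal C * eLpNorm f (ENNReal.ofReal (n / α)) volume) := by
    intro t
    rcases le_or_gt t h with ht | ht
    · rw [posPow_of_nonpos (sub_nonpos.2 ht)]; simp
    · have ht0 := hh.trans ht
      rw [enorm_smul]
      calc ‖posPow a (t - h)‖ₑ * ‖heatApply p t f x‖ₑ
          ≤ (‖posPow a t‖ₑ + ‖posPow a t - posPow a (t - h)‖ₑ) * ‖heatApply p t f x‖ₑ := by
            gcongr
            calc ‖posPow a (t - h)‖ₑ = ‖posPow a t - (posPow a t - posPow a (t - h))‖ₑ := by
                  rw [sub_sub_cancel]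
              _ ≤ _ := enorm_sub_le
        _ ≤ _ := by
            rw [add_mul]
            refine add_le_add le_rfl ?_
            rw [mul_assoc, ha', min_eq_right
              (Real.rpow_le_rpow_of_nonpos hh ht.le (by linarith)), ← mul_assoc (ENNReal.ofReal _),
              ← ENNReal.ofReal_mul (by positivity), mul_comm _ C]
            gcongr
            exact hC t ht0
  refine (lintegral_mono hle).trans_lt ?_
  rw [lintegral_add_left (by exact (measurable_posPow.enorm.mul hmu.enorm))]
  refine ENNReal.add_lt_top.2 ⟨hx, ?_⟩
  have hfin := ENNReal.mul_lt_top (ENNReal.ofReal_lt_top (r := C)) hf.2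
  rw [lintegral_mul_const' _ _ hfin.ne, lintegral_weight_scaled hh]
  exact ENNReal.mul_lt_top hW hfin

lemma integrable_posPow_smul_heatApply
    (hp : Measurable fun q : ℝ × Eucl n × Eucl n => p q.1 q.2.1 q.2.2)
    (hf : AEStronglyMeasurable f volume) {a : ℝ} {x : Eucl n}
    (hx : ∫⁻ t, ‖posPow a t‖ₑ * ‖heatApply p t f x‖ₑ < ⊤) :
    Integrable fun t => posPow a t • heatApply p t f x := by
  refine ⟨(measurable_posPow.smul (measurable_heatApply_left hp hf x)).aestronglyMeasurable, ?_⟩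
  simpa only [HasFiniteIntegral, enorm_smul] using hx

/-- The mean oscillation estimate. -/
lemma ballMean_fracPow_sub_le
    (hp : Measurable fun q : ℝ × Eucl n × Eucl n => p q.1 q.2.1 q.2.2)
    (hα : 0 < α) (hf : MemLp f (ENNReal.ofReal (n / α)) volume) {C : ℝ} (hC0 : 0 < C)
    (hC : ∀ t : ℝ, 0 < t → ∀ x, ‖heatApply p t f x‖ₑ ≤
      ENNReal.ofReal (C * t ^ (-(α / 2))) * eLpNorm f (ENNReal.ofReal (n / α)) volume)
    {r : ℝ} (hr : 0 < r) (y : Eucl n)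
    (hCm : ∀ t : ℝ, 0 < t → ballMean y r (heatApply p t f) ≤
        ENNReal.ofReal (C * min ((r ^ 2) ^ (-(α / 2))) (t ^ (-(α / 2)))) *
          eLpNorm f (ENNReal.ofReal (n / α)) volume)
    (hx : ∀ᵐ x ∂(volume : Measure (Eucl n)), fracPowAbs p α f x < ⊤) :
    ballMean y r (fun x => fracPow p α f x - heatFracPow p α (r ^ 2) f x) ≤
      ENNReal.ofReal ((Real.Gamma (α / 2))⁻¹ * C) * weightMass (α / 2 - 1) *
        eLpNorm f (ENNReal.ofReal (n / α)) volume := by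
  have hΓ := Real.Gamma_pos_of_pos (half_pos hα)
  have hh : 0 < r ^ 2 := by positivity
  set h := r ^ 2
  set a := α / 2 - 1 with ha
  have ha' : -(a + 1) = -(α / 2) := by rw [ha]; ring
  set G := ENNReal.ofReal (Real.Gamma (α / 2))⁻¹ with hG
  set V := volume (Metric.ball y r)
  have hVi : V⁻¹ ≠ ⊤ := ENNReal.inv_ne_top.2 (Metric.measure_ball_pos _ _ hr).ne'
  have hmu := measurable_heatApply hp hf.1
  have hmw : Measurable fun t => ‖posPow a t - posPow a (t - h)‖ₑ :=
    (measurable_posPow.sub (measurable_posPow.comp (measurable_id.sub_const h))).enorm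
  have hdiff : ∀ᵐ x ∂(volume : Measure (Eucl n)),
      ‖fracPow p α f x - heatFracPow p α h f x‖ₑ ≤
        G * ∫⁻ t, ‖posPow a t - posPow a (t - h)‖ₑ * ‖heatApply p t f x‖ₑ := by
    filter_upwards [hx] with x hx
    have hx' := lintegral_lt_top_of_fracPowAbs_lt_top hα hx
    rw [fracPow_eq, heatFracPow_eq, ← smul_sub,
      ← integral_sub (integrable_posPow_smul_heatApply hp hf.1 hx')
        (integrable_posPow_sub_smul_heatApply hp hα hf hC0 (fun t ht => hC t ht x) hx' hh),
      enorm_smul, Real.enorm_of_nonneg (inv_pos.2 hΓ).le]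
    gcongr
    refine (enorm_integral_le_lintegral_enorm _).trans (le_of_eq ?_)
    simp only [← sub_smul, enorm_smul]
    rfl
  calc ballMean y r (fun x => fracPow p α f x - heatFracPow p α h f x)
      ≤ V⁻¹ * ∫⁻ x in Metric.ball y r,
          G * ∫⁻ t, ‖posPow a t - posPow a (t - h)‖ₑ * ‖heatApply p t f x‖ₑ := by
        rw [ballMean]
        exact mul_le_mul_right (lintegral_mono_ae (ae_restrict_of_ae hdiff)) _
    -- Tonelli puts the average over the ball inside, at fixed time, where the bound by the minimum
    -- is available.
    _ = G * ∫⁻ t, ‖posPow a t - posPow a (t - h)‖ₑ * ballMean y r (heatApply p t f) := by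
        rw [lintegral_const_mul' _ _ ENNReal.ofReal_ne_top, mul_left_comm,
          lintegral_lintegral_swap, ← lintegral_const_mul' _ _ hVi]
        · congr 1
          refine lintegral_congr fun t => ?_
          rw [ballMean, lintegral_const_mul' _ _ enorm_ne_top, mul_left_comm]
        · exact ((hmw.comp measurable_snd).mul
            (hmu.comp measurable_swap).enorm).aemeasurable
    _ ≤ G * ∫⁻ t, ‖posPow a t - posPow a (t - h)‖ₑ *
          ENNReal.ofReal (min (h ^ (-(a + 1))) (t ^ (-(a + 1)))) *
          (ENNReal.ofReal C * eLpNorm f (ENNReal.ofReal (n / α)) volume) := by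
        refine mul_le_mul' le_rfl (lintegral_mono fun t => ?_)
        -- For `t ≤ 0` both weights vanish, so the values of the kernel and of the powers there are
        -- irrelevant.
        rcases le_or_gt t 0 with ht | ht
        · rw [posPow_of_nonpos ht, posPow_of_nonpos (by linarith : t - h ≤ 0)]; simp
        · simp only
          rw [mul_assoc, ha', ← mul_assoc (ENNReal.ofReal _),
            ← ENNReal.ofReal_mul (by positivity), mul_comm _ C]
          gcongr
          exact hCm t ht
    _ = _ := by
        have hfin := ENNReal.mul_lt_top (ENNReal.ofReal_lt_top (r := C)) hf.2
        rw [lintegral_mul_const' _ _ hfin.ne, lintegral_weight_scaled hh,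
          ENNReal.ofReal_mul (inv_pos.2 hΓ).le]
        ring

/-- The Gaussian is integrable against functions in the class `𝓜`. -/
lemma lintegral_gaussKernel_mul_lt_top_of_memM {g : Eucl n → ℝ} (hg : MemM g)
    (hA : 0 < A) (hb : 0 < b) {t : ℝ} (ht : 0 < t) (x : Eucl n) :
    ∫⁻ y, ENNReal.ofReal (gaussKernel A b t (x - y)) * ‖g y‖ₑ < ⊤ := by
  obtain ⟨-, d, hd, hi⟩ := hg
  have hsum := (integrable_gaussKernel_sq_mul_weight (n := n) (A := A) hb ht ((n : ℝ) + d)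
    (by positivity) x).add hi
  refine lt_of_le_of_lt (lintegral_mono fun y => ?_) hsum.2
  rw [← ofReal_norm, ← ofReal_norm, ← ENNReal.ofReal_mul (gaussKernel_nonneg hA ht _)]
  refine ENNReal.ofReal_le_ofReal (le_trans ?_ (le_abs_self _))
  have hw : 0 < 1 + ‖y‖ ^ ((n : ℝ) + d) := by positivity
  have hK := gaussKernel_nonneg (b := b) hA ht (x - y)
  simp only [Pi.add_apply]
  rw [← sub_nonneg]
  set w := 1 + ‖y‖ ^ ((n : ℝ) + d)
  set k := gaussKernel A b t (x - y)
  -- Completing the square gives `k|g| ≤ k²w + |g|²/w`, and both terms on the right are integrable.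
  have e : k ^ 2 * w + ‖g y‖ ^ 2 / w - k * ‖g y‖ =
      ((k * w - ‖g y‖ / 2) ^ 2 + 3 / 4 * ‖g y‖ ^ 2) / w := by field_simp; ring
  rw [e]
  positivity

lemma memM_fracPow (hp : Measurable fun q : ℝ × Eucl n × Eucl n => p q.1 q.2.1 q.2.2)
    (hα : 0 < α) (hf : AEStronglyMeasurable f volume)
    (hx : ∀ᵐ x ∂(volume : Measure (Eucl n)), fracPowAbs p α f x < ⊤)
    (hM : MemM fun x => (fracPowAbs p α f x).toReal) : MemM (fracPow p α f) := by
  obtain ⟨hloc, d, hd, hi⟩ := hM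
  have hm := measurable_fracPow (α := α) hp hf
  -- `toReal` sends `⊤` to `0`, so this domination needs finiteness, which holds almost everywhere.
  have hle : ∀ᵐ x ∂(volume : Measure (Eucl n)),
      ‖fracPow p α f x‖ ≤ ‖(fracPowAbs p α f x).toReal‖ := by
    filter_upwards [hx] with x hx
    rw [Real.norm_of_nonneg ENNReal.toReal_nonneg, ← toReal_enorm]
    exact ENNReal.toReal_mono hx.ne (enorm_fracPow_le hα x)
  refine ⟨hloc.mono hm.aestronglyMeasurable hle, d, hd, hi.mono ?_ ?_⟩
  · have : Measurable fun x => ‖fracPow p α f x‖ ^ 2 / (1 + ‖x‖ ^ ((n : ℝ) + d)) :=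
      (hm.norm.pow_const 2).div (measurable_const.add (measurable_norm.pow_const _))
    exact this.aestronglyMeasurable
  · filter_upwards [hle] with x hle
    rw [Real.norm_of_nonneg (by positivity), Real.norm_of_nonneg (by positivity)]
    gcongr

/-- `e^{-sL}` may be taken under the integral that defines `L^{-α/2} f`. -/
lemma heatApply_fracPow (hT : IsAnalyticSemigroup T) (hK : IsSemigroupKernel T p)
    (hG : GaussianBound A b p) (hα : 0 < α) (hαn : α < n) (hA : 0 < A) (hb : 0 < b)
    (hf : MemLp f (ENNReal.ofReal (n / α)) volume)
    (hx : ∀ᵐ x ∂(volume : Measure (Eucl n)), fracPowAbs p α f x < ⊤)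
    (hM : MemM fun x => (fracPowAbs p α f x).toReal) {s : ℝ} (hs : 0 < s) :
    heatApply p s (fracPow p α f) =ᵐ[volume] heatFracPow p α s f := by
  set a := α / 2 - 1 with ha
  have hΓ := Real.Gamma_pos_of_pos (half_pos hα)
  have hmu := measurable_heatApply hK.measurable hf.1
  have hmv : Measurable fun q : ℝ × Eucl n => heatApply p s (heatApply p q.1 f) q.2 := by
    refine (StronglyMeasurable.integral_prod_right (ν := (volume : Measure (Eucl n)))
      (f := fun (q : ℝ × Eucl n) (y : Eucl n) => p s q.2 y * heatApply p q.1 f y) ?_).measurable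
    refine Measurable.stronglyMeasurable ?_
    refine Measurable.mul ?_ (hmu.comp (measurable_fst.fst.prodMk measurable_snd))
    exact hK.measurable.comp
      (measurable_const.prodMk (measurable_fst.snd.prodMk measurable_snd))
  -- The exceptional null set in the semigroup law depends on `t`. Joint measurability lets Fubini
  -- exchange the two almost-everywhere quantifiers.
  have hlaw : ∀ᵐ x ∂(volume : Measure (Eucl n)), ∀ᵐ t : ℝ, 0 < t →
      heatApply p s (heatApply p t f) x = heatApply p (t + s) f x := by
    rw [Measure.ae_ae_comm]
    · refine ae_of_all _ fun t => ?_
      rcases le_or_gt t 0 with ht | ht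
      · exact ae_of_all _ fun x h => absurd h ht.not_gt
      · filter_upwards [heatApply_heatApply hT hK hG hα hαn hA hb hf hs ht] with x hx _
        rw [hx, add_comm]
    · have hset : MeasurableSet {z : Eucl n × ℝ | heatApply p s (heatApply p z.2 f) z.1 =
          heatApply p (z.2 + s) f z.1} :=
        measurableSet_eq_fun (hmv.comp measurable_swap)
          (hmu.comp ((measurable_snd.add_const s).prodMk measurable_fst))
      have : {z : Eucl n × ℝ | 0 < z.2 → heatApply p s (heatApply p z.2 f) z.1 =
          heatApply p (z.2 + s) f z.1} = {z : Eucl n × ℝ | 0 < z.2}ᶜ ∪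
          {z : Eucl n × ℝ | heatApply p s (heatApply p z.2 f) z.1 =
          heatApply p (z.2 + s) f z.1} := by
        ext z; simp [imp_iff_not_or]
      rw [this]
      exact (measurableSet_lt measurable_const measurable_snd).compl.union hset
  filter_upwards [hlaw] with x hlawx
  -- Integrating in `t` first produces `Γ(α/2) F(y)`, which is then paired with a Gaussian; this is
  -- where `F ∈ 𝓜` enters.
  have hint : Integrable (Function.uncurry fun (y : Eucl n) (t : ℝ) =>
      p s x y * (posPow a t • heatApply p t f y)) (volume.prod volume) := by
    have hms : Measurable (Function.uncurry fun (y : Eucl n) (t : ℝ) =>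
        p s x y * (posPow a t • heatApply p t f y)) :=
      ((measurable_kernel_right hK.measurable s x).comp measurable_fst).mul
        ((measurable_posPow.comp measurable_snd).smul (hmu.comp measurable_swap))
    refine ⟨hms.aestronglyMeasurable, ?_⟩
    rw [HasFiniteIntegral, lintegral_prod _ hms.enorm.aemeasurable]
    have hcalc : ∀ᵐ y ∂(volume : Measure (Eucl n)),
        ∫⁻ t, ‖p s x y * (posPow a t • heatApply p t f y)‖ₑ ≤
          ENNReal.ofReal (Real.Gamma (α / 2)) *
            (ENNReal.ofReal (gaussKernel A b s (x - y)) * ‖(fracPowAbs p α f y).toReal‖ₑ) := by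
      filter_upwards [hx] with y hy
      rw [Real.enorm_of_nonneg ENNReal.toReal_nonneg, ENNReal.ofReal_toReal hy.ne, fracPowAbs_eq,
        mul_left_comm, ← mul_assoc (ENNReal.ofReal (Real.Gamma (α / 2))),
        ← ENNReal.ofReal_mul hΓ.le, mul_inv_cancel₀ hΓ.ne', ENNReal.ofReal_one, one_mul]
      simp only [enorm_mul, enorm_smul]
      rw [lintegral_const_mul' _ _ enorm_ne_top]
      gcongr
      exact hG.enorm_le hs x y
    refine (lintegral_mono_ae hcalc).trans_lt ?_
    rw [lintegral_const_mul' _ _ ENNReal.ofReal_ne_top]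
    exact ENNReal.mul_lt_top ENNReal.ofReal_lt_top
      (lintegral_gaussKernel_mul_lt_top_of_memM hM hA hb hs x)
  calc heatApply p s (fracPow p α f) x
      = ∫ y, ((Real.Gamma (α / 2))⁻¹ : ℝ) •
          ∫ t, p s x y * (posPow a t • heatApply p t f y) := by
        refine integral_congr_ae (ae_of_all _ fun y => ?_)
        simp only
        rw [fracPow_eq, mul_smul_comm, ← integral_const_mul]
    _ = ((Real.Gamma (α / 2))⁻¹ : ℝ) •
          ∫ t, ∫ y, p s x y * (posPow a t • heatApply p t f y) := by
        rw [integral_smul, integral_integral_swap hint]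
    _ = heatFracPow p α s f x := by
        rw [heatFracPow, integral_Ioi_rpow_smul (fun t => heatApply p (t + s) f x)]
        congr 1
        refine integral_congr_ae ?_
        filter_upwards [hlawx] with t ht
        rcases le_or_gt t 0 with ht0 | ht0
        · simp [posPow_of_nonpos ht0]
        · rw [← ht ht0]
          simp only [mul_smul_comm]
          rw [integral_smul]
          rfl

end FracPow
-- The theorem
theorem theorem5p2 (n : ℕ) (α : ℝ) (hα : 0 < α) (hαn : α < n)
    (A b : ℝ) (hA : 0 < A) (hb : 0 < b) :
    ∃ c : ℝ, 0 < c ∧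
      ∀ (L : L2Space n →ₗ.[ℂ] L2Space n) (T : ℝ → L2Space n →L[ℂ] L2Space n)
        (p : ℝ → Eucl n → Eucl n → ℂ),
        IsAnalyticSemigroup T → IsSemigroupOf L T → IsSemigroupKernel T p →
        GaussianBound A b p →
        ∀ f : Eucl n → ℂ, MemLp f (ENNReal.ofReal (n / α)) volume →
          (∀ᵐ x ∂(volume : Measure (Eucl n)), fracPowAbs p α f x < ⊤) →
          -- the mean oscillation estimate, for every such `f`
          ((∀ r : ℝ, 0 < r →
              (∀ᵐ x ∂(volume : Measure (Eucl n)), IntegrableOn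
                (fun t : ℝ => (t ^ (α / 2 - 1) : ℝ) • heatApply p (t + r ^ 2) f x) (Ioi 0)) ∧
              ∀ y : Eucl n,
                ballMean y r (fun x => fracPow p α f x - heatFracPow p α (r ^ 2) f x) ≤
                  ENNReal.ofReal c * eLpNorm f (ENNReal.ofReal (n / α)) volume) ∧
          -- membership in the space, as soon as the integral converges absolutely in `𝓜`
            (MemM (fun x => (fracPowAbs p α f x).toReal) →
              MemBMO p (fracPow p α f) ∧
              (∀ r : ℝ, 0 < r → heatApply p (r ^ 2) (fracPow p α f)
                =ᵐ[volume] heatFracPow p α (r ^ 2) f) ∧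
              bmoNorm p (fracPow p α f) ≤
                ENNReal.ofReal c * eLpNorm f (ENNReal.ofReal (n / α)) volume)) := by
  obtain ⟨C, hC0, hC⟩ := ballMean_heatApply_le (n := n) hα hαn hA hb
  have hΓ := Real.Gamma_pos_of_pos (half_pos hα)
  have hW := weightMass_lt_top (a := α / 2 - 1) (by linarith)
  -- The summand `1` gives positivity without a lower bound on the mass.
  refine ⟨(Real.Gamma (α / 2))⁻¹ * C * (weightMass (α / 2 - 1)).toReal + 1, by positivity, ?_⟩
  intro L T p hT _ hK hG f hf hx
  have hCt := hC p hG f hf.1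
  have hosc : ∀ r : ℝ, 0 < r → ∀ y : Eucl n,
      ballMean y r (fun x => fracPow p α f x - heatFracPow p α (r ^ 2) f x) ≤
        ENNReal.ofReal ((Real.Gamma (α / 2))⁻¹ * C * (weightMass (α / 2 - 1)).toReal + 1) *
          eLpNorm f (ENNReal.ofReal (n / α)) volume := by
    intro r hr y
    refine (ballMean_fracPow_sub_le hK.measurable hα hf hC0 (fun t ht => (hCt t ht).1) hr y
      (fun t ht => (hCt t ht).2 r y hr) hx).trans ?_
    gcongr
    rw [← ENNReal.ofReal_toReal hW.ne, ← ENNReal.ofReal_mul (by positivity),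
      ENNReal.toReal_ofReal ENNReal.toReal_nonneg]
    exact ENNReal.ofReal_le_ofReal (by linarith)
  refine ⟨fun r hr => ⟨?_, hosc r hr⟩, fun hM => ?_⟩
  · filter_upwards [hx] with x hx
    rw [integrableOn_Ioi_rpow_smul_iff (fun t => heatApply p (t + r ^ 2) f x)]
    have h := (integrable_posPow_sub_smul_heatApply hK.measurable hα hf hC0
      (fun t ht => (hCt t ht).1 x) (lintegral_lt_top_of_fracPowAbs_lt_top hα hx)
      (by positivity : 0 < r ^ 2)).comp_add_right (r ^ 2)
    simpa using h
  · have hcomm : ∀ r : ℝ, 0 < r → heatApply p (r ^ 2) (fracPow p α f)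
        =ᵐ[volume] heatFracPow p α (r ^ 2) f := fun r hr =>
      heatApply_fracPow hT hK hG hα hαn hA hb hf hx hM (by positivity)
    have hbmo : bmoNorm p (fracPow p α f) ≤
        ENNReal.ofReal ((Real.Gamma (α / 2))⁻¹ * C * (weightMass (α / 2 - 1)).toReal + 1) *
          eLpNorm f (ENNReal.ofReal (n / α)) volume := by
      refine iSup_le fun y => iSup_le fun r => iSup_le fun hr => ?_
      refine le_trans (le_of_eq ?_) (hosc r hr y)
      rw [ballMean, ballMean]
      congr 1
      refine lintegral_congr_ae (ae_restrict_of_ae ?_)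
      filter_upwards [hcomm r hr] with x hx
      rw [hx]
    exact ⟨⟨memM_fracPow hK.measurable hα hf.1 hx hM,
      hbmo.trans_lt (ENNReal.mul_lt_top ENNReal.ofReal_lt_top hf.2)⟩, hcomm, hbmo⟩
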